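/- (1) Let $\mathcal{D}$ be a triangulated category with (set-indexed) coproducts, let $(\mathcal{U},\mathcal{U}^{\perp}[1])$ be a t-structure on $\mathcal{D}$ and let $\mathcal{H}=\mathcal{U}\cap\mathcal{U}^{\perp}[1]$ be its heart. Let $H:\mathcal{D}\to\mathcal{A}$ be a cohomological functor to an abelian category, put $H^{k}(X)=H(X[k])$ for $k\in\mathbb{Z}$, and let $r\in\mathbb{Z}\cup\{+\infty\}$ be such that every object $X$ of $\mathcal{H}$ with $H^{k}(X)=0$ for all integers $k<r$ is zero. Let $I$ be a small category such that $I$-colimits exist and are exact in $\mathcal{A}$. If, for each diagram $X:I\to\mathcal{H}$ and each integer $k<r$, the canonical morphism $\operatorname{colim}_I H^{k}(X_i)\to H^{k}(\operatorname{colim}_{\mathcal{H}} X_i)$ is an isomorphism, then $I$-colimits exist and are exact in the abelian category $\mathcal{H}$. (2) Let $\mathcal{G}$ be a Grothendieck category, let $(\mathcal{U},\mathcal{U}^{\perp}[1])$ be any t-structure on its (unbounded) derived category $\mathcal{D}(\mathcal{G})$ and let $\mathcal{H}=\mathcal{U}\cap\mathcal{U}^{\perp}[1]$ be its heart. If the restrictions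 $H^{m}:\mathcal{H}\to\mathcal{G}$ of the classical homology functors preserve direct limits (colimits indexed by upward directed sets) for all $m\in\mathbb{Z}$, then $\mathcal{H}$ is an AB5 abelian category, i.e. it is abelian, has coproducts, and direct limits are exact in it. -/

import Mathlib

open CategoryTheory Limits Pretriangulated Triangulated

namespace HeartAB5

universe w v v' u u'

/-- Colimits of shape `I` exist in `C` and are exact. -/
def ExactColimits (I : Type u') [Category.{v'} I] (C : Type u) [Category.{v} C] : Prop :=
  ∃ _ : HasColimitsOfShape I C, HasExactColimitsOfShape I C

/-- `C` is an AB5 abelian category, relative to the universe `w` of small sets: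
it is abelian, it has small coproducts (AB3), and small filtered colimits are exact in it. -/
structure IsAB5Abelian (C : Type u) [Category.{v} C] : Prop where
  abelian : Nonempty (Abelian C)
  hasCoproducts : HasCoproducts.{w} C
  exact : ∃ _ : HasFilteredColimitsOfSize.{w, w} C, AB5OfSize.{w, w} C

/-- The functor `F` preserves direct limits, i.e. colimits indexed by (non-empty) upward
directed ordered sets in the universe `w`. -/
def PreservesDirectLimits {C : Type u} [Category.{v} C] {C' : Type u'} [Category.{v'} C']
    (F : C ⥤ C') : Prop :=
  ∀ (J : Type w) [PartialOrder J] [IsDirectedOrder J] [Nonempty J], PreservesColimitsOfShape J F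

section

variable {D : Type u} [Category.{v} D] [Preadditive D] [HasZeroObject D] [HasShift D ℤ]
  [∀ n : ℤ, (shiftFunctor D n).Additive] [Pretriangulated D]
  {A : Type u'} [Category.{v'} A] [Abelian A]

/-- `H^k`, the functor `X ↦ H (X[k])`. -/
abbrev cohomology (H : D ⥤ A) (k : ℤ) : D ⥤ A := shiftFunctor D k ⋙ H

/-- `(H, r)`, with `r ∈ ℤ ∪ {+∞}`, is a cohomological datum with respect to the full subcategory
`P` of `D`: `H` is a cohomological functor to an abelian category, and an object `X` of `P` such
that `H^k X = 0` for all integers `k < r` is zero. -/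
structure IsCohomologicalDatum (P : ObjectProperty D) (H : D ⥤ A) (r : WithTop ℤ) : Prop where
  isHomological : H.IsHomological
  isZero (X : D) (hX : P X)
    (h : ∀ k : ℤ, (k : WithTop ℤ) < r → IsZero ((cohomology H k).obj X)) : IsZero X

end

end HeartAB5

universe w w' v v' u u'

/-!
A short exact sequence in the heart of a t-structure is a distinguished triangle, functorially, so
the functors `H^k` form a `δ`-functor on the heart. Let `f : X ⟶ Y` be a monomorphism of diagrams in
the heart with cokernel `Z`, let `K` be the kernel of `colim Y ⟶ colim Z`, and let
`q : colim X ⟶ K` be the canonical epimorphism. Since `H^k` commutes with colimits for `k < r`, the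
five lemma compares the colimit of the long exact sequences of `0 ⟶ X i ⟶ Y i ⟶ Z i ⟶ 0` with the
long exact sequence of `0 ⟶ K ⟶ colim Y ⟶ colim Z ⟶ 0`, and shows that `H^k q` is an isomorphism
for `k < r`. Then `H^k (ker q) = 0` for `k < r`, hence `ker q = 0`, and `colim f` is a monomorphism.

Coproducts in the heart are truncations of coproducts in the ambient category. In the derived
category of an abelian category with exact coproducts, the latter are computed degreewise, because a
coproduct of quasi-isomorphisms is a quasi-isomorphism. As every filtered category admits a final
functor from a directed set, the exactness of direct limits is that of all filtered colimits.
-/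

namespace HeartAB5

section Coproducts

variable {C : Type*} [Category* C] {D : Type*} [Category* D] {α : Type*}
  [HasColimitsOfShape (Discrete α) C]

lemma preservesColimitsOfShape_discrete_of_existsUnique (F : C ⥤ D) [F.EssSurj]
    (h : ∀ (X : α → C) (Y : C) (f : ∀ i, F.obj (X i) ⟶ F.obj Y),
      ∃! g : F.obj (∐ X) ⟶ F.obj Y, ∀ i, F.map (Sigma.ι X i) ≫ g = f i) :
    PreservesColimitsOfShape (Discrete α) F := by
  have (X : α → C) : PreservesColimit (Discrete.functor X) F := by
    refine preservesColimit_of_preserves_colimit_cocone (coproductIsCoproduct X)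
      ((isColimitMapCoconeCofanMkEquiv F X _).symm ?_)
    have hX (s : Cofan fun i ↦ F.obj (X i)) :
        ∃! g : F.obj (∐ X) ⟶ s.pt, ∀ i, F.map (Sigma.ι X i) ≫ g = s.inj i := by
      let e := F.objObjPreimageIso s.pt
      obtain ⟨g, hg, hg'⟩ := h X _ fun i ↦ s.inj i ≫ e.inv
      exact ⟨g ≫ e.hom, fun i ↦ by rw [reassoc_of% hg i, e.inv_hom_id, Category.comp_id],
        fun m hm ↦ by rw [← hg' (m ≫ e.inv) fun i ↦ by rw [reassoc_of% hm i],
          Category.assoc, e.inv_hom_id, Category.comp_id]⟩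
    choose desc fac uniq using hX
    exact Cofan.IsColimit.mk _ desc fac uniq
  exact preservesColimitsOfShape_of_discrete F

lemma hasColimitsOfShape_discrete_of_essSurj (F : C ⥤ D) [F.EssSurj]
    [PreservesColimitsOfShape (Discrete α) F] : HasColimitsOfShape (Discrete α) D where
  has_colimit K := hasColimit_of_iso (Discrete.natIso (F := K)
    (G := Discrete.functor (fun i ↦ F.objPreimage (K.obj ⟨i⟩)) ⋙ F)
    fun i ↦ (F.objObjPreimageIso (K.obj i)).symm)

lemma sigmaMap_mem {W : MorphismProperty C} [W.IsStableUnderCoproductsOfShape α] {X Y : α → C}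
    {s : ∀ i, X i ⟶ Y i} (hs : ∀ i, W (s i)) : W (Limits.Sigma.map s) :=
  W.colimMap _ fun ⟨i⟩ ↦ hs i

lemma isStableUnderCoproductsOfShape_of_inverseImage (F : C ⥤ D) [F.Full] [F.EssSurj]
    [PreservesColimitsOfShape (Discrete α) F] (W : MorphismProperty D) [W.RespectsIso]
    [(W.inverseImage F).IsStableUnderCoproductsOfShape α] :
    W.IsStableUnderCoproductsOfShape α := by
  refine .mk _ _ fun X Y _ _ f hf ↦ ?_
  let eX (i : α) := F.objObjPreimageIso (X i)
  let eY (i : α) := F.objObjPreimageIso (Y i)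
  choose φ hφ using fun i ↦ F.map_surjective ((eX i).hom ≫ f i ≫ (eY i).inv)
  have hW (i : α) : W.inverseImage F (φ i) := by
    refine (W.arrow_mk_iso_iff (Arrow.isoMk (eX i) (eY i) ?_)).2 (hf i)
    simp [hφ]
  have := hasColimitsOfShape_discrete_of_essSurj (α := α) F
  let e (Z : α → D) : ∐ Z ≅ F.obj (∐ fun i ↦ F.objPreimage (Z i)) :=
    Sigma.mapIso (fun i ↦ (F.objObjPreimageIso (Z i)).symm) ≪≫ (PreservesCoproduct.iso F _).symm
  have he (Z : α → D) (i : α) : Sigma.ι Z i ≫ (e Z).hom =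
      (F.objObjPreimageIso (Z i)).inv ≫ F.map (Sigma.ι (fun i ↦ F.objPreimage (Z i)) i) := by
    simp [e, Sigma.mapIso]
  refine (W.arrow_mk_iso_iff (Arrow.isoMk (e X) (e Y) ?_)).2 (sigmaMap_mem hW)
  exact Sigma.hom_ext _ _ fun i ↦ by
    simp [reassoc_of% he X i, he Y i, ← F.map_comp, hφ, eX, eY]

section Localization

variable (L : C ⥤ D) (W : MorphismProperty C) [L.IsLocalization W]
  [W.HasRightCalculusOfFractions] [W.IsStableUnderCoproductsOfShape α]
include W

lemma exists_sigma_desc_of_isLocalization {X : α → C} {Y : C}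
    (f : ∀ i, L.obj (X i) ⟶ L.obj Y) :
    ∃ g : L.obj (∐ X) ⟶ L.obj Y, ∀ i, L.map (Sigma.ι X i) ≫ g = f i := by
  choose φ hφ using fun i ↦ Localization.exists_rightFraction L W (f i)
  have := Localization.inverts L W _ (sigmaMap_mem fun i ↦ (φ i).hs)
  refine ⟨inv (L.map (Limits.Sigma.map fun i ↦ (φ i).s)) ≫
    L.map (Sigma.desc fun i ↦ (φ i).f), fun i ↦ ?_⟩
  have := Localization.inverts L W _ (φ i).hs
  rw [hφ i, ← cancel_epi (L.map (φ i).s), MorphismProperty.RightFraction.map_s_comp_map,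
    ← Functor.map_comp_assoc, ← Sigma.ι_map (fun i ↦ (φ i).s), Functor.map_comp_assoc,
    IsIso.hom_inv_id_assoc, ← Functor.map_comp, Sigma.ι_desc]

variable [W.HasLeftCalculusOfFractions]

lemma sigma_hom_ext_of_isLocalization {X : α → C} {Y : C} {f g : L.obj (∐ X) ⟶ L.obj Y}
    (h : ∀ i, L.map (Sigma.ι X i) ≫ f = L.map (Sigma.ι X i) ≫ g) : f = g := by
  obtain ⟨φ, rfl, rfl⟩ := Localization.exists_leftFraction₂ L W f g
  have hφ (i : α) : L.map (Sigma.ι X i ≫ φ.f) = L.map (Sigma.ι X i ≫ φ.f') := by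
    simpa only [Functor.map_comp, Category.assoc, φ.fst.map_comp_map_s, φ.snd.map_comp_map_s]
      using h i =≫ L.map φ.s
  choose Z t ht htφ using fun i ↦ (MorphismProperty.map_eq_iff_precomp L W _ _).1 (hφ i)
  have := Localization.inverts L W _ φ.hs
  have := Localization.inverts L W _ (sigmaMap_mem ht)
  rw [← cancel_mono (L.map φ.s), φ.fst.map_comp_map_s L, φ.snd.map_comp_map_s L,
    ← cancel_epi (L.map (Limits.Sigma.map t)), ← L.map_comp, ← L.map_comp]
  congr 1
  exact Sigma.hom_ext _ _ fun i ↦ by simpa using htφ i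

lemma preservesColimitsOfShape_discrete_of_isLocalization :
    PreservesColimitsOfShape (Discrete α) L :=
  have := Localization.essSurj L W
  preservesColimitsOfShape_discrete_of_existsUnique L fun _ _ f ↦
    have ⟨g, hg⟩ := exists_sigma_desc_of_isLocalization L W f
    ⟨g, hg, fun _ hg' ↦ sigma_hom_ext_of_isLocalization L W fun i ↦ (hg' i).trans (hg i).symm⟩

end Localization

end Coproducts

section HomotopyCategory

variable {C : Type*} [Category* C] [Preadditive C] {ι : Type*} {c : ComplexShape ι} {α : Type*}
  [HasColimitsOfShape (Discrete α) C]

lemma quotient_map_sigma_hom_ext {K : α → HomologicalComplex C c} {L : HomologicalComplex C c}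
    {f g : ∐ K ⟶ L} (h : ∀ i, (HomotopyCategory.quotient C c).map (Sigma.ι K i ≫ f) =
      (HomotopyCategory.quotient C c).map (Sigma.ι K i ≫ g)) :
    (HomotopyCategory.quotient C c).map f = (HomotopyCategory.quotient C c).map g := by
  let hK (n : ι) : IsColimit (Cofan.mk ((∐ K).X n) fun i ↦ (Sigma.ι K i).f n) :=
    isColimitCofanMkObjOfIsColimit (HomologicalComplex.eval C c n) K _ (coproductIsCoproduct K)
  let σ (i : α) : Homotopy (Sigma.ι K i ≫ f) (Sigma.ι K i ≫ g) :=
    HomotopyCategory.homotopyOfEq _ _ (h i)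
  let τ (n m : ι) : (∐ K).X n ⟶ L.X m := Cofan.IsColimit.desc (hK n) fun i ↦ (σ i).hom n m
  have hτ (i : α) (n m : ι) : (Sigma.ι K i).f n ≫ τ n m = (σ i).hom n m :=
    Cofan.IsColimit.fac (hK n) _ i
  refine HomotopyCategory.eq_of_homotopy _ _ ⟨τ, fun n m hnm ↦ ?_, fun n ↦ ?_⟩
  · refine Cofan.IsColimit.hom_ext (hK n) _ _ fun i ↦ ?_
    exact (hτ i n m).trans (((σ i).zero n m hnm).trans comp_zero.symm)
  · refine Cofan.IsColimit.hom_ext (hK n) _ _ fun i ↦ ?_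
    have := (σ i).comm n
    rw [show (σ i).hom = fun n m ↦ (Sigma.ι K i).f n ≫ τ n m from
      funext₂ fun n m ↦ (hτ i n m).symm, dNext_comp_left, prevD_comp_left,
      HomologicalComplex.comp_f, HomologicalComplex.comp_f, ← Preadditive.comp_add,
      ← Preadditive.comp_add] at this
    exact this

instance preservesColimitsOfShape_discrete_quotient :
    PreservesColimitsOfShape (Discrete α) (HomotopyCategory.quotient C c) :=
  preservesColimitsOfShape_discrete_of_existsUnique _ fun K L f ↦ by
    choose f' hf' using fun i ↦ (HomotopyCategory.quotient C c).map_surjective (f i)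
    refine ⟨(HomotopyCategory.quotient C c).map (Sigma.desc f'), fun i ↦ ?_, fun g hg ↦ ?_⟩
    · rw [← Functor.map_comp, Sigma.ι_desc, hf']
    · obtain ⟨g, rfl⟩ := (HomotopyCategory.quotient C c).map_surjective g
      refine quotient_map_sigma_hom_ext fun i ↦ ?_
      rw [Functor.map_comp, hg, Sigma.ι_desc, hf']

instance hasColimitsOfShape_discrete_homotopyCategory :
    HasColimitsOfShape (Discrete α) (HomotopyCategory C c) :=
  hasColimitsOfShape_discrete_of_essSurj (HomotopyCategory.quotient C c)

end HomotopyCategory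

section QuasiIso

variable {C : Type*} [Category* C] {ι : Type*} {c : ComplexShape ι} {J : Type*} [Category* J]

/-- A diagram of complexes, regarded as a complex of diagrams. -/
@[simps]
def complexOfDiagram [HasZeroMorphisms C] :
    (J ⥤ HomologicalComplex C c) ⥤ HomologicalComplex (J ⥤ C) c where
  obj F :=
    { X := fun n ↦ F ⋙ HomologicalComplex.eval C c n
      d := fun n m ↦
        { app := fun j ↦ (F.obj j).d n m
          naturality := fun _ _ f ↦ (F.map f).comm n m }
      d_comp_d' := fun n m l _ _ ↦ by
        ext j
        exact (F.obj j).d_comp_d n m l }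
  map φ :=
    { f := fun n ↦ Functor.whiskerRight φ (HomologicalComplex.eval C c n)
      comm' := fun n m _ ↦ by
        ext j
        exact (φ.app j).comm n m }

variable [Abelian C] [HasColimitsOfShape J C] [HasExactColimitsOfShape J C]

lemma quasiIso_map_colim_complexOfDiagram {F G : J ⥤ HomologicalComplex C c} (φ : F ⟶ G)
    (hφ : ∀ j, QuasiIso (φ.app j)) :
    QuasiIso ((colim.mapHomologicalComplex c).map (complexOfDiagram.map φ)) := by
  have : QuasiIso (complexOfDiagram.map φ) :=
    (HomologicalComplex.quasiIso_iff_evaluation _).2 hφ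
  have : (colim (J := J) (C := C)).PreservesHomology := Functor.preservesHomologyOfExact _
  exact HomologicalComplex.quasiIso_map_of_preservesHomology _ colim

instance isStableUnderColimitsOfShape_quasiIso :
    (HomologicalComplex.quasiIso C c).IsStableUnderColimitsOfShape J where
  condition F G a b ha hb φ hφ ψ hψ := by
    let eF := ha.coconePointUniqueUpToIso (HomologicalComplex.isColimitCoconeOfHasColimitEval F)
    let eG := hb.coconePointUniqueUpToIso (HomologicalComplex.isColimitCoconeOfHasColimitEval G)
    let ψ' : (HomologicalComplex.coconeOfHasColimitEval F).pt ⟶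
        (HomologicalComplex.coconeOfHasColimitEval G).pt :=
      (colim.mapHomologicalComplex c).map (complexOfDiagram.map φ)
    have hι (j : J) : (HomologicalComplex.coconeOfHasColimitEval F).ι.app j ≫ ψ' =
        φ.app j ≫ (HomologicalComplex.coconeOfHasColimitEval G).ι.app j := by
      ext n
      exact ι_colimMap (Functor.whiskerRight φ (HomologicalComplex.eval C c n)) j
    have hψ' : eF.hom ≫ ψ' = ψ ≫ eG.hom := ha.hom_ext fun j ↦ by
      simp only [eF, eG, IsColimit.comp_coconePointUniqueUpToIso_hom_assoc, hι,
        reassoc_of% hψ j, IsColimit.comp_coconePointUniqueUpToIso_hom]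
    refine ((HomologicalComplex.quasiIso C c).arrow_mk_iso_iff (Arrow.isoMk eF eG hψ')).2 ?_
    exact quasiIso_map_colim_complexOfDiagram φ hφ

end QuasiIso

section DerivedCategory

variable {C : Type*} [Category* C] [Abelian C] {α : Type*} [HasColimitsOfShape (Discrete α) C]
  [HasExactColimitsOfShape (Discrete α) C]

instance isStableUnderCoproductsOfShape_quasiIso_homotopyCategory {ι : Type*}
    {c : ComplexShape ι} : (HomotopyCategory.quasiIso C c).IsStableUnderCoproductsOfShape α := by
  have h : (HomotopyCategory.quasiIso C c).inverseImage (HomotopyCategory.quotient C c) =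
      HomologicalComplex.quasiIso C c := by
    ext K L f
    exact HomotopyCategory.quotient_map_mem_quasiIso_iff f
  have : ((HomotopyCategory.quasiIso C c).inverseImage
      (HomotopyCategory.quotient C c)).IsStableUnderCoproductsOfShape α := by
    rw [h]
    infer_instance
  exact isStableUnderCoproductsOfShape_of_inverseImage (HomotopyCategory.quotient C c) _

lemma hasColimitsOfShape_discrete_derivedCategory [HasDerivedCategory C] :
    HasColimitsOfShape (Discrete α) (DerivedCategory C) :=
  have := preservesColimitsOfShape_discrete_of_isLocalization (α := α) DerivedCategory.Qh
    (HomotopyCategory.quasiIso C (.up ℤ))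
  have := Localization.essSurj (DerivedCategory.Qh (C := C)) (HomotopyCategory.quasiIso C (.up ℤ))
  hasColimitsOfShape_discrete_of_essSurj (DerivedCategory.Qh (C := C))

end DerivedCategory

section DeltaFunctor

lemma exact_of_evaluation {I : Type*} [Category* I] {A : Type*} [Category* A] [Abelian A]
    {S : ShortComplex (I ⥤ A)} (h : ∀ i, (S.map ((evaluation I A).obj i)).Exact) : S.Exact := by
  rw [ShortComplex.exact_iff_isZero_homology, Functor.isZero_iff]
  intro i
  exact ((ShortComplex.exact_iff_isZero_homology _).1 (h i)).of_iso
    (S.mapHomologyIso ((evaluation I A).obj i)).symm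

lemma shortExact_evaluation {I : Type*} [Category* I] {B : Type*} [Category* B] [Abelian B]
    {S : ShortComplex (I ⥤ B)} (hS : S.ShortExact) (i : I) :
    (S.map ((evaluation I B).obj i)).ShortExact :=
  hS.map_of_exact _

lemma ι_comp_comp_eq_of_colimMap_comp {I B : Type*} [Category* I] [Category* B]
    [HasColimitsOfShape I B] {X Y : I ⥤ B} {α : X ⟶ Y} {P Q : B} {f : colimit X ⟶ P}
    {g : colimit Y ⟶ Q} {h : P ⟶ Q} (w : colimMap α ≫ g = f ≫ h) (i : I) :
    (colimit.ι X i ≫ f) ≫ h = α.app i ≫ colimit.ι Y i ≫ g := by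
  rw [Category.assoc, ← w, ι_colimMap_assoc]

lemma colimMap_whiskerRight_post {I B A : Type*} [Category* I] [Category* B] [Category* A]
    [HasColimitsOfShape I B] [HasColimitsOfShape I A] {X Y : I ⥤ B} {α : X ⟶ Y} {P Q : B}
    {f : colimit X ⟶ P} {g : colimit Y ⟶ Q} {h : P ⟶ Q} (w : colimMap α ≫ g = f ≫ h)
    (F : B ⥤ A) : colimMap (Functor.whiskerRight α F) ≫ colimit.post Y F ≫ F.map g =
      (colimit.post X F ≫ F.map f) ≫ F.map h := by
  rw [Category.assoc, ← F.map_comp, ← w, F.map_comp]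
  exact (reassoc_of% colimit.map_post (α := α) F) (F.map g) |>.symm

/-- A cohomological `δ`-functor from `B` to `A`: functors `F k` for `k : ℤ`, together with natural
connecting morphisms which turn short exact sequences in `B` into long exact sequences in `A`. -/
structure DeltaFunctor (B : Type*) [Category* B] [HasZeroMorphisms B] (A : Type*) [Category* A]
    [HasZeroMorphisms A] where
  F : ℤ → B ⥤ A
  preservesZeroMorphisms (k : ℤ) : (F k).PreservesZeroMorphisms := by infer_instance
  δ {S : ShortComplex B} (hS : S.ShortExact) (k₀ k₁ : ℤ) (hk : k₀ + 1 = k₁) :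
    (F k₀).obj S.X₃ ⟶ (F k₁).obj S.X₁
  δ_naturality {S S' : ShortComplex B} (hS : S.ShortExact) (hS' : S'.ShortExact) (φ : S ⟶ S')
    (k₀ k₁ : ℤ) (hk : k₀ + 1 = k₁) :
    (F k₀).map φ.τ₃ ≫ δ hS' k₀ k₁ hk = δ hS k₀ k₁ hk ≫ (F k₁).map φ.τ₁
  comp_δ {S : ShortComplex B} (hS : S.ShortExact) (k₀ k₁ : ℤ) (hk : k₀ + 1 = k₁) :
    (F k₀).map S.g ≫ δ hS k₀ k₁ hk = 0
  δ_comp {S : ShortComplex B} (hS : S.ShortExact) (k₀ k₁ : ℤ) (hk : k₀ + 1 = k₁) :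
    δ hS k₀ k₁ hk ≫ (F k₁).map S.f = 0
  exact₁ {S : ShortComplex B} (hS : S.ShortExact) (k₀ k₁ : ℤ) (hk : k₀ + 1 = k₁) :
    (ShortComplex.mk _ _ (δ_comp hS k₀ k₁ hk)).Exact
  exact₂ {S : ShortComplex B} (hS : S.ShortExact) (k : ℤ) : (S.map (F k)).Exact
  exact₃ {S : ShortComplex B} (hS : S.ShortExact) (k₀ k₁ : ℤ) (hk : k₀ + 1 = k₁) :
    (ShortComplex.mk _ _ (comp_δ hS k₀ k₁ hk)).Exact

namespace DeltaFunctor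

attribute [instance] preservesZeroMorphisms

variable {B : Type*} [Category* B] {A : Type*} [Category* A] [Abelian A]

section

variable [HasZeroMorphisms B] (T : DeltaFunctor B A)

/-- The `δ`-functor obtained by applying an exact functor to the values of a `δ`-functor. -/
@[simps F]
def comp {A' : Type*} [Category* A'] [Abelian A'] (G : A ⥤ A') [G.PreservesZeroMorphisms]
    [G.PreservesHomology] : DeltaFunctor B A' where
  F k := T.F k ⋙ G
  δ hS k₀ k₁ hk := G.map (T.δ hS k₀ k₁ hk)
  δ_naturality hS hS' φ k₀ k₁ hk := by
    simp only [Functor.comp_map, ← G.map_comp, T.δ_naturality hS hS']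
  comp_δ hS k₀ k₁ hk := by simp only [Functor.comp_map, ← G.map_comp, T.comp_δ, G.map_zero]
  δ_comp hS k₀ k₁ hk := by simp only [Functor.comp_map, ← G.map_comp, T.δ_comp, G.map_zero]
  exact₁ hS k₀ k₁ hk := (T.exact₁ hS k₀ k₁ hk).map G
  exact₂ hS k := (T.exact₂ hS k).map G
  exact₃ hS k₀ k₁ hk := (T.exact₃ hS k₀ k₁ hk).map G

lemma longExact {S : ShortComplex B} (hS : S.ShortExact) (k₀ k₁ : ℤ) (hk : k₀ + 1 = k₁) :
    (ComposableArrows.mk₄ ((T.F k₀).map S.g) (T.δ hS k₀ k₁ hk)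
      ((T.F k₁).map S.f) ((T.F k₁).map S.g)).Exact :=
  ComposableArrows.exact_of_δ₀ (T.exact₃ hS k₀ k₁ hk).exact_toComposableArrows
    (ComposableArrows.exact_of_δ₀ (T.exact₁ hS k₀ k₁ hk).exact_toComposableArrows
      (T.exact₂ hS k₁).exact_toComposableArrows)

lemma isZero_obj_X₁ {S : ShortComplex B} (hS : S.ShortExact) (k₀ k₁ : ℤ) (hk : k₀ + 1 = k₁)
    [Epi ((T.F k₀).map S.g)] [Mono ((T.F k₁).map S.g)] : IsZero ((T.F k₁).obj S.X₁) := by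
  refine (T.exact₁ hS k₀ k₁ hk).isZero_of_both_zeros ?_ ?_
  · exact zero_of_epi_comp _ (T.comp_δ hS k₀ k₁ hk)
  · exact zero_of_comp_mono ((T.F k₁).map S.g) (S.map (T.F k₁)).zero

end

section

variable [Abelian B] (T : DeltaFunctor B A)

/-- The `δ`-functor between categories of diagrams given by a `δ`-functor applied pointwise. -/
@[simps F]
noncomputable def diagram (I : Type*) [Category* I] : DeltaFunctor (I ⥤ B) (I ⥤ A) where
  F k := (Functor.whiskeringRight I B A).obj (T.F k)
  preservesZeroMorphisms k := ⟨fun X Y ↦ by ext; exact (T.F k).map_zero _ _⟩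
  δ {S} hS k₀ k₁ hk :=
    { app i := T.δ (shortExact_evaluation hS i) k₀ k₁ hk
      naturality i j f := T.δ_naturality (shortExact_evaluation hS i) (shortExact_evaluation hS j)
        (S.mapNatTrans ((evaluation I B).map f)) k₀ k₁ hk }
  δ_naturality {S S'} hS hS' φ k₀ k₁ hk := by
    ext i
    exact T.δ_naturality (shortExact_evaluation hS i) (shortExact_evaluation hS' i)
      (((evaluation I B).obj i).mapShortComplex.map φ) k₀ k₁ hk
  comp_δ hS k₀ k₁ hk := by
    ext i
    exact T.comp_δ (shortExact_evaluation hS i) k₀ k₁ hk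
  δ_comp hS k₀ k₁ hk := by
    ext i
    exact T.δ_comp (shortExact_evaluation hS i) k₀ k₁ hk
  exact₁ hS k₀ k₁ hk :=
    exact_of_evaluation fun i ↦ T.exact₁ (shortExact_evaluation hS i) k₀ k₁ hk
  exact₂ hS k := exact_of_evaluation fun i ↦ T.exact₂ (shortExact_evaluation hS i) k
  exact₃ hS k₀ k₁ hk :=
    exact_of_evaluation fun i ↦ T.exact₃ (shortExact_evaluation hS i) k₀ k₁ hk

lemma mono_of_isIso_map {s : Set ℤ} (hs : IsLowerSet s)
    (hT : ∀ X : B, (∀ k ∈ s, IsZero ((T.F k).obj X)) → IsZero X) {X Y : B} (q : X ⟶ Y) [Epi q]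
    (hq : ∀ k ∈ s, IsIso ((T.F k).map q)) : Mono q := by
  have hK : (ShortComplex.mk (kernel.ι q) q (kernel.condition q)).ShortExact :=
    { exact := ShortComplex.exact_kernel q }
  refine Preadditive.mono_of_kernel_zero ((hT (kernel q) fun k hk ↦ ?_).eq_zero_of_src _)
  have := hq k hk
  have := hq (k - 1) (hs (by lia) hk)
  exact T.isZero_obj_X₁ hK (k - 1) k (by lia)

section Colimits

variable {I : Type*} [Category* I] [HasColimitsOfShape I B] [HasColimitsOfShape I A]

/-- The `δ`-functor on diagrams of shape `I` given by the colimits of the values of a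
`δ`-functor. -/
noncomputable abbrev colimDiagram [HasExactColimitsOfShape I A] : DeltaFunctor (I ⥤ B) A :=
  have : (colim (J := I) (C := A)).PreservesHomology := Functor.preservesHomologyOfExact _
  (T.diagram I).comp colim

variable [HasExactColimitsOfShape I A]

section

variable {S : ShortComplex (I ⥤ B)} (hS : S.ShortExact) {S' : ShortComplex B} (hS' : S'.ShortExact)
  {f₁ : colimit S.X₁ ⟶ S'.X₁} {f₂ : colimit S.X₂ ⟶ S'.X₂} {f₃ : colimit S.X₃ ⟶ S'.X₃}
  (comm₁₂ : colimMap S.f ≫ f₂ = f₁ ≫ S'.f) (comm₂₃ : colimMap S.g ≫ f₃ = f₂ ≫ S'.g)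
  (k₀ k₁ : ℤ) (hk : k₀ + 1 = k₁)
include hS hS' comm₁₂ comm₂₃ hk

lemma colimDiagram_δ_post :
    T.colimDiagram.δ hS k₀ k₁ hk ≫ colimit.post S.X₁ (T.F k₁) ≫ (T.F k₁).map f₁ =
      (colimit.post S.X₃ (T.F k₀) ≫ (T.F k₀).map f₃) ≫ T.δ hS' k₀ k₁ hk := by
  refine colimit.hom_ext fun i ↦ ?_
  let φ : S.map ((evaluation I B).obj i) ⟶ S' :=
    { τ₁ := colimit.ι S.X₁ i ≫ f₁
      τ₂ := colimit.ι S.X₂ i ≫ f₂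
      τ₃ := colimit.ι S.X₃ i ≫ f₃
      comm₁₂ := ι_comp_comp_eq_of_colimMap_comp comm₁₂ i
      comm₂₃ := ι_comp_comp_eq_of_colimMap_comp comm₂₃ i }
  let d : (T.F k₀).obj (S.X₃.obj i) ⟶ (T.F k₁).obj (S.X₁.obj i) :=
    T.δ (shortExact_evaluation hS i) k₀ k₁ hk
  have hd : d ≫ colimit.ι (S.X₁ ⋙ T.F k₁) i ≫ colimit.post S.X₁ (T.F k₁) ≫ (T.F k₁).map f₁ =
      colimit.ι (S.X₃ ⋙ T.F k₀) i ≫ (colimit.post S.X₃ (T.F k₀) ≫ (T.F k₀).map f₃) ≫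
        T.δ hS' k₀ k₁ hk := by
    rw [colimit.ι_post_assoc, Category.assoc, colimit.ι_post_assoc, ← Functor.map_comp,
      ← Functor.map_comp_assoc]
    exact (T.δ_naturality (shortExact_evaluation hS i) hS' φ k₀ k₁ hk).symm
  exact (ι_colimMap_assoc ((T.diagram I).δ hS k₀ k₁ hk) i _).trans hd

lemma isIso_map_of_isIso_colimit [IsIso f₂] [IsIso f₃]
    [PreservesColimitsOfShape I (T.F k₀)] [PreservesColimitsOfShape I (T.F k₁)] :
    IsIso ((T.F k₁).map f₁) := by
  let ψ : ComposableArrows.mk₄ (T.colimDiagram.F k₀ |>.map S.g) (T.colimDiagram.δ hS k₀ k₁ hk)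
      (T.colimDiagram.F k₁ |>.map S.f) (T.colimDiagram.F k₁ |>.map S.g) ⟶
    ComposableArrows.mk₄ ((T.F k₀).map S'.g) (T.δ hS' k₀ k₁ hk)
      ((T.F k₁).map S'.f) ((T.F k₁).map S'.g) :=
    ComposableArrows.homMk₄
      (colimit.post S.X₂ (T.F k₀) ≫ (T.F k₀).map f₂)
      (colimit.post S.X₃ (T.F k₀) ≫ (T.F k₀).map f₃)
      (colimit.post S.X₁ (T.F k₁) ≫ (T.F k₁).map f₁)
      (colimit.post S.X₂ (T.F k₁) ≫ (T.F k₁).map f₂)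
      (colimit.post S.X₃ (T.F k₁) ≫ (T.F k₁).map f₃)
      (colimMap_whiskerRight_post comm₂₃ (T.F k₀))
      (T.colimDiagram_δ_post hS hS' comm₁₂ comm₂₃ k₀ k₁ hk)
      (colimMap_whiskerRight_post comm₁₂ (T.F k₁)) (colimMap_whiskerRight_post comm₂₃ (T.F k₁))
  have h₀ : Epi (colimit.post S.X₂ (T.F k₀) ≫ (T.F k₀).map f₂) := inferInstance
  have h₁ : IsIso (colimit.post S.X₃ (T.F k₀) ≫ (T.F k₀).map f₃) := inferInstance
  have h₃ : IsIso (colimit.post S.X₂ (T.F k₁) ≫ (T.F k₁).map f₂) := inferInstance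
  have h₄ : Mono (colimit.post S.X₃ (T.F k₁) ≫ (T.F k₁).map f₃) := inferInstance
  have : IsIso (colimit.post S.X₁ (T.F k₁) ≫ (T.F k₁).map f₁) :=
    Abelian.isIso_of_epi_of_isIso_of_isIso_of_mono (T.colimDiagram.longExact hS k₀ k₁ hk)
      (T.longExact hS' k₀ k₁ hk) ψ h₀ h₁ h₃ h₄
  exact IsIso.of_isIso_comp_left (colimit.post S.X₁ (T.F k₁)) _

end

lemma preservesMonomorphisms_colim {s : Set ℤ} (hs : IsLowerSet s)
    (hT : ∀ X : B, (∀ k ∈ s, IsZero ((T.F k).obj X)) → IsZero X)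
    (hI : ∀ k ∈ s, PreservesColimitsOfShape I (T.F k)) :
    (colim (J := I) (C := B)).PreservesMonomorphisms where
  preserves {X Y} f _ := by
    let S := ShortComplex.mk f (cokernel.π f) (cokernel.condition f)
    have hS : S.ShortExact := { exact := ShortComplex.exact_cokernel f }
    have hSc : (S.map colim).Exact :=
      hS.exact.map_of_epi_of_preservesCokernel colim hS.epi_g inferInstance
    let p : colimit X ⟶ colimit Y := colim.map f
    let g : colimit Y ⟶ colimit S.X₃ := colim.map S.g
    let q : colimit X ⟶ kernel g := kernel.lift g p (S.map colim).zero
    have hq : q ≫ kernel.ι g = p := kernel.lift_ι g p _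
    have : Epi q := (S.map colim).exact_iff_epi_kernel_lift.1 hSc
    have : Epi g := inferInstanceAs (Epi (colim.map (cokernel.π f)))
    have hS' : (ShortComplex.mk (kernel.ι g) g (kernel.condition g)).ShortExact :=
      { exact := ShortComplex.exact_kernel g }
    have : Mono q := T.mono_of_isIso_map hs hT q fun k hk ↦ by
      have := hI k hk
      have := hI (k - 1) (hs (by lia) hk)
      exact T.isIso_map_of_isIso_colimit hS hS' (f₁ := q) (f₂ := 𝟙 _) (f₃ := 𝟙 _)
        ((Category.comp_id _).trans hq.symm)
        ((Category.comp_id _).trans (Category.id_comp _).symm) (k - 1) k (by lia)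
    change Mono p
    rw [← hq]
    exact mono_comp q (kernel.ι g)

lemma hasExactColimitsOfShape {s : Set ℤ} (hs : IsLowerSet s)
    (hT : ∀ X : B, (∀ k ∈ s, IsZero ((T.F k).obj X)) → IsZero X)
    (hI : ∀ k ∈ s, PreservesColimitsOfShape I (T.F k)) : HasExactColimitsOfShape I B :=
  have := T.preservesMonomorphisms_colim hs hT hI
  hasExactColimitsOfShape_of_preservesMono B I

end Colimits

end

end DeltaFunctor
end DeltaFunctor

section AbelianSubcategory

variable {D : Type*} [Category* D] [Preadditive D] [HasZeroObject D] [HasShift D ℤ]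
  [∀ n : ℤ, (shiftFunctor D n).Additive] [Pretriangulated D]

lemma distinguished_of_iso_obj₁ {X X' Y Z : D} {f : X ⟶ Y} {g : Y ⟶ Z} {h : Z ⟶ X⟦(1 : ℤ)⟧}
    (hT : Triangle.mk f g h ∈ distTriang D) (e : X' ≅ X) :
    Triangle.mk (e.hom ≫ f) g (h ≫ e.inv⟦(1 : ℤ)⟧') ∈ distTriang D := by
  have hh : (h ≫ e.inv⟦(1 : ℤ)⟧') ≫ e.hom⟦(1 : ℤ)⟧' = h := by simp [← Functor.map_comp]
  exact isomorphic_distinguished _ hT _ (Triangle.isoMk _ _ e (Iso.refl Y) (Iso.refl Z)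
    (Category.comp_id (e.hom ≫ f)) ((Category.comp_id g).trans (Category.id_comp g).symm)
    (hh.trans (Category.id_comp h).symm))

lemma mor₃_comp_eq_comp_mor₃ {T T' : Triangle D} (hT : T ∈ distTriang D) (hT' : T' ∈ distTriang D)
    (hzero : ∀ d : T.obj₁⟦(1 : ℤ)⟧ ⟶ T'.obj₃, d = 0)
    {a : T.obj₁ ⟶ T'.obj₁} {b : T.obj₂ ⟶ T'.obj₂} {c : T.obj₃ ⟶ T'.obj₃}
    (hab : T.mor₁ ≫ b = a ≫ T'.mor₁) (hbc : T.mor₂ ≫ c = b ≫ T'.mor₂) :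
    T.mor₃ ≫ a⟦(1 : ℤ)⟧' = c ≫ T'.mor₃ := by
  obtain ⟨c', hbc', hca'⟩ := complete_distinguished_triangle_morphism T T' hT hT' a b hab
  obtain ⟨d, hd⟩ := Triangle.yoneda_exact₃ T hT (c - c') (by
    rw [Preadditive.comp_sub, hbc, hbc', sub_self])
  rw [hzero d, comp_zero, sub_eq_zero] at hd
  rw [hd, hca']

variable {B : Type*} [Category* B] [Abelian B] {ι : B ⥤ D} [ι.Full] [ι.Faithful] [ι.Additive]
  (hι : ∀ ⦃X Y : B⦄ ⦃n : ℤ⦄ (f : ι.obj X ⟶ (ι.obj Y)⟦n⟧), n < 0 → f = 0)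
  (hadm : AbelianSubcategory.admissibleMorphism ι = ⊤)

include hι hadm in
lemma exists_distinguished_of_shortExact {S : ShortComplex B} (hS : S.ShortExact) :
    ∃ δ : ι.obj S.X₃ ⟶ (ι.obj S.X₁)⟦(1 : ℤ)⟧,
      Triangle.mk (ι.map S.f) (ι.map S.g) δ ∈ distTriang D := by
  have := hS.epi_g
  obtain ⟨K, i, δ, hT⟩ := AbelianSubcategory.exists_distinguished_triangle_of_epi hι hadm S.g
  let e := IsLimit.conePointUniqueUpToIso hS.fIsKernel
    (AbelianSubcategory.isLimitKernelForkOfDistTriang hι i S.g δ hT)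
  have he : e.hom ≫ i = S.f := IsLimit.conePointUniqueUpToIso_hom_comp _ _ WalkingParallelPair.zero
  have := distinguished_of_iso_obj₁ hT (ι.mapIso e)
  rw [Functor.mapIso_hom, ← Functor.map_comp, he] at this
  exact ⟨_, this⟩

/-- The triangle attached to a short exact sequence in an admissible abelian subcategory of a
pretriangulated category. Its third morphism is chosen, but is in fact unique. -/
noncomputable def triangleOfShortExact {S : ShortComplex B} (hS : S.ShortExact) : Triangle D :=
  Triangle.mk (ι.map S.f) (ι.map S.g) (exists_distinguished_of_shortExact hι hadm hS).choose

lemma triangleOfShortExact_distinguished {S : ShortComplex B} (hS : S.ShortExact) :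
    triangleOfShortExact hι hadm hS ∈ distTriang D :=
  (exists_distinguished_of_shortExact hι hadm hS).choose_spec

/-- The morphism of triangles induced by a morphism of short exact sequences. It is compatible with
the third morphisms, however these are chosen. -/
@[simps]
noncomputable def triangleOfShortExactMap {S S' : ShortComplex B} (hS : S.ShortExact)
    (hS' : S'.ShortExact) (φ : S ⟶ S') :
    triangleOfShortExact hι hadm hS ⟶ triangleOfShortExact hι hadm hS' :=
  have comm₁ := (ι.mapShortComplex.map φ).comm₁₂.symm
  have comm₂ := (ι.mapShortComplex.map φ).comm₂₃.symm
  { hom₁ := ι.map φ.τ₁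
    hom₂ := ι.map φ.τ₂
    hom₃ := ι.map φ.τ₃
    comm₁ := comm₁
    comm₂ := comm₂
    comm₃ := mor₃_comp_eq_comp_mor₃ (triangleOfShortExact_distinguished hι hadm hS)
      (triangleOfShortExact_distinguished hι hadm hS')
      (fun d ↦ AbelianSubcategory.eq_zero_of_hom_shift_pos hι d one_pos) comm₁ comm₂ }

/-- The `δ`-functor given by the restriction of a homological functor to an admissible abelian
subcategory. -/
noncomputable def DeltaFunctor.ofIsHomological {A : Type*} [Category* A] [Abelian A] (H : D ⥤ A)
    [H.IsHomological] [H.ShiftSequence ℤ] : DeltaFunctor B A where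
  F k := ι ⋙ H.shift k
  δ hS k₀ k₁ hk := H.homologySequenceδ (triangleOfShortExact hι hadm hS) k₀ k₁ hk
  δ_naturality hS hS' φ k₀ k₁ hk :=
    H.homologySequenceδ_naturality _ _ (triangleOfShortExactMap hι hadm hS hS' φ) k₀ k₁ hk
  comp_δ hS k₀ k₁ hk :=
    H.comp_homologySequenceδ _ (triangleOfShortExact_distinguished hι hadm hS) k₀ k₁ hk
  δ_comp hS k₀ k₁ hk :=
    H.homologySequenceδ_comp _ (triangleOfShortExact_distinguished hι hadm hS) k₀ k₁ hk
  exact₁ hS k₀ k₁ hk :=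
    H.homologySequence_exact₁ _ (triangleOfShortExact_distinguished hι hadm hS) k₀ k₁ hk
  exact₂ hS k := H.homologySequence_exact₂ _ (triangleOfShortExact_distinguished hι hadm hS) k
  exact₃ hS k₀ k₁ hk :=
    H.homologySequence_exact₃ _ (triangleOfShortExact_distinguished hι hadm hS) k₀ k₁ hk

end AbelianSubcategory

section Heart

variable {D : Type*} [Category* D] [Preadditive D] [HasZeroObject D] [HasShift D ℤ]
  [∀ n : ℤ, (shiftFunctor D n).Additive] [Pretriangulated D]

lemma isClosedUnderFiniteProducts_of_isTriangulatedClosed₂ (P : ObjectProperty D)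
    [P.ContainsZero] [P.IsTriangulatedClosed₂] [P.IsClosedUnderIsomorphisms] :
    P.IsClosedUnderFiniteProducts := by
  have : P.IsClosedUnderBinaryProducts :=
    { limitsOfShape_le := by
        rintro X ⟨p⟩
        have e : X ≅ p.diag.obj ⟨.left⟩ ⊞ p.diag.obj ⟨.right⟩ :=
          p.isLimit.conePointUniqueUpToIso (limit.isLimit p.diag) ≪≫
            HasLimit.isoOfNatIso (diagramIsoPair p.diag) ≪≫ (biprod.isoProd _ _).symm
        exact P.prop_of_iso e.symm (P.ext_of_isTriangulatedClosed₂ _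
          (binaryBiproductTriangle_distinguished _ _) (p.prop_diag_obj _) (p.prop_diag_obj _)) }
  exact .mk'

variable (t : TStructure D)

instance isLE_obj_heart (X : t.heart.FullSubcategory) : t.IsLE X.obj 0 := ⟨X.property.1⟩

instance isGE_obj_heart (X : t.heart.FullSubcategory) : t.IsGE X.obj 0 := ⟨X.property.2⟩

instance isTriangulatedClosed₂_heart : t.heart.IsTriangulatedClosed₂ :=
  .mk' fun T hT h₁ h₃ ↦ by
    rw [t.mem_heart_iff] at h₁ h₃ ⊢
    exact ⟨t.isLE₂ T hT 0 h₁.1 h₃.1, t.isGE₂ T hT 0 h₁.2 h₃.2⟩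

instance containsZero_heart : t.heart.ContainsZero :=
  ⟨⟨_, isZero_zero D, (t.mem_heart_iff _).2 ⟨inferInstance, inferInstance⟩⟩⟩

instance hasFiniteProducts_heart : HasFiniteProducts t.heart.FullSubcategory :=
  have := isClosedUnderFiniteProducts_of_isTriangulatedClosed₂ t.heart
  ⟨fun _ ↦ inferInstance⟩

lemma heart_hom_shift_eq_zero ⦃X Y : t.heart.FullSubcategory⦄ ⦃n : ℤ⦄
    (f : t.heart.ι.obj X ⟶ (t.heart.ι.obj Y)⟦n⟧) (hn : n < 0) : f = 0 :=
  t.zero_of_isLE_of_isGE f 0 (-n) (by lia) (isLE_obj_heart t X) (t.isGE_shift Y.obj 0 n (-n))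

lemma isZero_heart_iff (X : t.heart.FullSubcategory) : IsZero X ↔ IsZero X.obj := by
  simp only [IsZero.iff_id_eq_zero, ObjectProperty.hom_ext_iff]
  rfl

section Coproducts

variable {α : Type*}

lemma isLE_sigma (Y : α → D) [HasCoproduct Y] (n : ℤ) [∀ a, t.IsLE (Y a) n] :
    t.IsLE (∐ Y) n := by
  rw [t.isLE_iff_orthogonal n (n + 1) rfl]
  intro Z f hZ
  ext a
  rw [t.zero (Sigma.ι Y a ≫ f) n (n + 1), comp_zero]

variable [IsTriangulated D]

lemma hasCoproduct_heart (X : α → t.heart.FullSubcategory)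
    [HasCoproduct fun a ↦ (X a).obj] : HasCoproduct X := by
  let Y : D := ∐ fun a ↦ (X a).obj
  have : t.IsLE Y 0 := isLE_sigma t _ 0
  let c : Cofan X := Cofan.mk
    (⟨(t.truncGE 0).obj Y, (t.mem_heart_iff _).2 ⟨inferInstance, inferInstance⟩⟩ :
      t.heart.FullSubcategory)
    fun a ↦ ObjectProperty.homMk (Sigma.ι (fun a ↦ (X a).obj) a ≫ (t.truncGEπ 0).app Y)
  refine ⟨⟨c, Cofan.IsColimit.mk c
    (fun s ↦ ObjectProperty.homMk (t.descTruncGE (Sigma.desc fun a ↦ (s.inj a).hom) 0))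
    (fun s a ↦ ?_) (fun s m hm ↦ ?_)⟩⟩
  · ext
    simp [c, Y]
  · ext
    refine t.from_truncGE_obj_ext
      ((Sigma.hom_ext _ _ fun a ↦ ?_).trans (t.π_descTruncGE _ 0).symm)
    rw [Sigma.ι_desc, ← hm a]
    exact (Category.assoc _ _ _).symm

lemma hasCoproductsOfShape_heart [HasCoproductsOfShape α D] :
    HasCoproductsOfShape α t.heart.FullSubcategory :=
  have := hasCoproduct_heart (α := α) t
  ⟨fun _ ↦ hasColimit_of_iso Discrete.natIsoFunctor⟩

end Coproducts

variable [IsTriangulated D]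

/- For `f : X₁ ⟶ X₂` in the heart with cone `X₃`, the cokernel of `f` is `τ≥0 X₃` and its kernel is
`(τ<0 X₃)⟦-1⟧`. -/
lemma admissibleMorphism_heart_eq_top :
    AbelianSubcategory.admissibleMorphism t.heart.ι = ⊤ := by
  refine eq_top_iff.2 fun X₁ X₂ f _ X₃ f₂ f₃ hT ↦ ?_
  have : t.IsLE (X₁.obj⟦(1 : ℤ)⟧) (-1) := t.isLE_shift X₁.obj 0 1 (-1)
  have : t.IsLE X₃ 0 := t.isLE₂ _ (rot_of_distTriang _ hT) 0 (isLE_obj_heart t X₂)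
    (t.isLE_of_le (X₁.obj⟦(1 : ℤ)⟧) (-1) 0)
  have : t.IsGE X₃ (-1) := t.isGE₂ _ (rot_of_distTriang _ hT) (-1)
    (t.isGE_of_ge X₂.obj (-1) 0) (t.isGE_shift X₁.obj 0 1 (-1))
  have : t.IsLE ((t.truncLT 0).obj X₃) (-1) := t.isLE_truncLT_obj X₃ 0 (-1)
  have hQ : t.heart ((t.truncGE 0).obj X₃) := (t.mem_heart_iff _).2 ⟨inferInstance, inferInstance⟩
  have hK : t.heart (((t.truncLT 0).obj X₃)⟦(-1 : ℤ)⟧) :=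
    (t.mem_heart_iff _).2 ⟨t.isLE_shift _ (-1) (-1) 0, t.isGE_shift _ (-1) (-1) 0⟩
  exact ⟨⟨_, hK⟩, ⟨_, hQ⟩, _, _, _, distinguished_of_iso_obj₁ (t.triangleLTGE_distinguished 0 X₃)
    ((shiftEquiv D (1 : ℤ)).counitIso.app _)⟩

/-- The abelian category structure on the heart of a t-structure. It extends the preadditive
structure inherited from the ambient category. -/
noncomputable abbrev abelianHeart : Abelian t.heart.FullSubcategory :=
  AbelianSubcategory.abelian t.heart.ι (heart_hom_shift_eq_zero t)
    (admissibleMorphism_heart_eq_top t)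

attribute [local instance] abelianHeart

lemma hasColimitsOfShape_heart (I : Type w) [Category.{w} I] [HasCoproductsOfShape I D]
    [HasCoproductsOfShape (Σ p : I × I, p.1 ⟶ p.2) D] :
    HasColimitsOfShape I t.heart.FullSubcategory :=
  have := hasCoproductsOfShape_heart (α := I) t
  have := hasCoproductsOfShape_heart (α := Σ p : I × I, p.1 ⟶ p.2) t
  ⟨fun F ↦ hasColimit_of_coequalizer_and_coproduct F⟩

lemma exactColimits_heart {A : Type*} [Category* A] [Abelian A] {H : D ⥤ A} {r : WithTop ℤ}
    (hH : IsCohomologicalDatum t.heart H r) {I : Type*} [Category* I]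
    [HasColimitsOfShape I t.heart.FullSubcategory] (hA : ExactColimits I A)
    (hI : ∀ k : ℤ, (k : WithTop ℤ) < r →
      PreservesColimitsOfShape I (t.heart.ι ⋙ cohomology H k)) :
    ExactColimits I t.heart.FullSubcategory := by
  obtain ⟨_, _⟩ := hA
  have := hH.isHomological
  let := Functor.ShiftSequence.tautological H ℤ
  let T : DeltaFunctor t.heart.FullSubcategory A :=
    .ofIsHomological (heart_hom_shift_eq_zero t) (admissibleMorphism_heart_eq_top t) H
  have hs : IsLowerSet {k : ℤ | (k : WithTop ℤ) < r} :=
    fun _ _ h hk ↦ (WithTop.coe_le_coe.2 h).trans_lt hk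
  exact ⟨inferInstance, T.hasExactColimitsOfShape hs
    (fun X hX ↦ (isZero_heart_iff t X).2 (hH.isZero X.obj X.property hX)) hI⟩

end Heart

section DerivedHeart

variable {G : Type u} [Category.{v} G] [Abelian G] [HasDerivedCategory.{w'} G]

lemma isZero_of_isZero_homology {X : DerivedCategory G}
    (hX : ∀ k : ℤ, IsZero ((DerivedCategory.homologyFunctor G k).obj X)) : IsZero X := by
  have : IsIso (0 : X ⟶ X) := by
    rw [DerivedCategory.isIso_iff]
    exact fun k ↦ ⟨0, (hX k).eq_of_src _ _, (hX k).eq_of_src _ _⟩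
  rw [IsZero.iff_id_eq_zero, ← IsIso.hom_inv_id (0 : X ⟶ X), zero_comp]

lemma isCohomologicalDatum_homologyFunctor (P : ObjectProperty (DerivedCategory G)) :
    IsCohomologicalDatum P (DerivedCategory.homologyFunctor G 0) ⊤ where
  isHomological := inferInstance
  isZero X _ h := isZero_of_isZero_homology fun k ↦
    (h k (WithTop.coe_lt_top k)).of_iso
      (((DerivedCategory.homologyFunctor G 0).isoShift k).app X).symm

variable (G) in
lemma hasCoproducts_derivedCategory [HasFilteredColimitsOfSize.{w, w} G] [AB5OfSize.{w, w} G] :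
    HasCoproducts.{w} (DerivedCategory G) := fun α ↦
  have : HasCoproducts.{w} G := hasCoproducts_of_finite_and_filtered
  have : HasFiniteBiproducts G := HasFiniteBiproducts.of_hasFiniteCoproducts
  have : HasExactColimitsOfShape (Discrete α) G := (AB4.of_AB5 G).ofShape α
  hasColimitsOfShape_discrete_derivedCategory

attribute [local instance] abelianHeart

lemma exactColimits_heart_derivedCategory {J : Type*} [Category* J] [HasColimitsOfShape J G]
    [HasExactColimitsOfShape J G] (t : TStructure (DerivedCategory G))
    [HasColimitsOfShape J t.heart.FullSubcategory]
    (ht : ∀ m : ℤ, PreservesColimitsOfShape J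
      (t.heart.ι ⋙ DerivedCategory.homologyFunctor G m)) :
    ExactColimits J t.heart.FullSubcategory := by
  refine exactColimits_heart t (isCohomologicalDatum_homologyFunctor _)
    ⟨inferInstance, inferInstance⟩ fun k _ ↦ ?_
  have : PreservesColimitsOfShape J
      (t.heart.ι ⋙ (DerivedCategory.homologyFunctor G 0).shift k) := ht k
  exact preservesColimitsOfShape_of_natIso (Functor.isoWhiskerLeft t.heart.ι
    ((DerivedCategory.homologyFunctor G 0).isoShift k).symm)

lemma ab5OfSize_of_exactColimits_of_isDirectedOrder {C : Type*} [Category* C] [HasFiniteLimits C]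
    [HasFilteredColimitsOfSize.{w, w} C]
    (hC : ∀ (J : Type w) [PartialOrder J] [IsDirectedOrder J] [Nonempty J], ExactColimits J C) :
    AB5OfSize.{w, w} C where
  ofShape J _ _ := by
    obtain ⟨J', _, _, _, F, _⟩ := IsFiltered.exists_directed J
    obtain ⟨_, _⟩ := hC J'
    exact hasExactColimitsOfShape_of_final _ F

lemma isAB5Abelian_heart_derivedCategory [HasFilteredColimitsOfSize.{w, w} G]
    [AB5OfSize.{w, w} G] (t : TStructure (DerivedCategory G))
    (ht : ∀ m : ℤ, PreservesDirectLimits.{w}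
      (t.heart.ι ⋙ DerivedCategory.homologyFunctor G m)) :
    IsAB5Abelian.{w} t.heart.FullSubcategory := by
  have := hasCoproducts_derivedCategory.{w} G
  have (J : Type w) [Category.{w} J] := hasColimitsOfShape_heart t J
  have : HasFilteredColimitsOfSize.{w, w} t.heart.FullSubcategory := ⟨fun _ ↦ inferInstance⟩
  exact
    { abelian := ⟨abelianHeart t⟩
      hasCoproducts := fun _ ↦ inferInstance
      exact := ⟨this, ab5OfSize_of_exactColimits_of_isDirectedOrder fun J ↦
        exactColimits_heart_derivedCategory t fun m ↦ ht m J⟩ }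

end DerivedHeart

theorem mainTheorem1_general :
    (∀ (D : Type u) [Category.{v} D] [Preadditive D] [HasZeroObject D] [HasShift D ℤ]
        [∀ n : ℤ, (shiftFunctor D n).Additive] [Pretriangulated D] [IsTriangulated D]
        (t : TStructure D) (A : Type u') [Category.{v'} A] [Abelian A] (H : D ⥤ A) (r : WithTop ℤ)
        (I : Type w) [Category.{w} I] [HasCoproductsOfShape I D]
        [HasCoproductsOfShape (Σ p : I × I, p.1 ⟶ p.2) D],
        IsCohomologicalDatum t.heart H r →
        ExactColimits I A →
        (∀ k : ℤ, (k : WithTop ℤ) < r →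
          PreservesColimitsOfShape I (t.heart.ι ⋙ cohomology H k)) →
        Nonempty (Abelian t.heart.FullSubcategory) ∧ ExactColimits I t.heart.FullSubcategory) ∧
    (∀ (G : Type u) [Category.{v} G] [Abelian G] [HasFilteredColimitsOfSize.{w, w} G]
        [AB5OfSize.{w, w} G] [HasDerivedCategory.{w'} G] (t : TStructure (DerivedCategory G)),
        (∀ m : ℤ, PreservesDirectLimits.{w}
          (t.heart.ι ⋙ DerivedCategory.homologyFunctor G m)) →
        IsAB5Abelian.{w} t.heart.FullSubcategory) := by
  refine ⟨fun D _ _ _ _ _ _ _ t A _ _ H r I _ _ _ hH hA hI ↦ ⟨⟨abelianHeart t⟩, ?_⟩,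
    fun G _ _ _ _ _ t ht ↦ isAB5Abelian_heart_derivedCategory t ht⟩
  have := hasColimitsOfShape_heart t I
  exact exactColimits_heart t hH hA hI

end HeartAB5

theorem mainTheorem1 :
    -- the general criterion
    (∀ (D : Type u) [Category.{v} D] [Preadditive D] [HasZeroObject D] [HasShift D ℤ]
        [∀ n : ℤ, (shiftFunctor D n).Additive] [Pretriangulated D] [IsTriangulated D]
        [HasCoproducts.{w} D] (t : TStructure D)
        (A : Type u') [Category.{v'} A] [Abelian A] (H : D ⥤ A) (r : WithTop ℤ)
        (I : Type w) [Category.{w} I],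
        HeartAB5.IsCohomologicalDatum t.heart H r →
        HeartAB5.ExactColimits I A →
        (∀ k : ℤ, (k : WithTop ℤ) < r →
          PreservesColimitsOfShape I (t.heart.ι ⋙ HeartAB5.cohomology H k)) →
        Nonempty (Abelian t.heart.FullSubcategory) ∧
          HeartAB5.ExactColimits I t.heart.FullSubcategory) ∧
    -- hearts in the derived category of a Grothendieck category
    (∀ (G : Type u) [Category.{v} G] [Abelian G] [IsGrothendieckAbelian.{w} G]
        [HasDerivedCategory.{w'} G] (t : TStructure (DerivedCategory G)),
        (∀ m : ℤ, HeartAB5.PreservesDirectLimits.{w}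
          (t.heart.ι ⋙ DerivedCategory.homologyFunctor G m)) →
        HeartAB5.IsAB5Abelian.{w} t.heart.FullSubcategory) :=
  ⟨fun D _ _ _ _ _ _ _ _ t A _ _ H r I _ ↦
      HeartAB5.mainTheorem1_general.{w, w', v, v', u, u'}.1 D t A H r I,
    fun G _ _ _ _ ↦ HeartAB5.mainTheorem1_general.{w, w', v, v', u, u'}.2 G⟩
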